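/- Let $n\ge 2$ and $k\ge 0$ be integers, let $f$ be a continuous even real-valued function on the unit sphere $S^{n-1}\subset\mathbb R^n$, and let $$H(x)=\int_{S^{n-1}}|\langle x,\xi\rangle|^{2k+1}f(\xi)\,d\xi,\qquad x\in\mathbb R^n,$$ where $d\xi$ is the (unnormalized) spherical Lebesgue measure. Put $C_t=\dfrac{2^{t+1}\sqrt{\pi}\,\Gamma((t+1)/2)}{\Gamma(-t/2)}$. Then $H\in C^{2k+2}(\mathbb R^n\setminus\{0\})$, and for every multi-index $\alpha=(\alpha_1,\dots,\alpha_n)$ of nonnegative integers with $\alpha_1+\cdots+\alpha_n=2k+2$ and every $x\in\mathbb R^n\setminus\{0\}$, $$\Big(\frac{\partial}{\partial x_1}\Big)^{\alpha_1}\cdots\Big(\frac{\partial}{\partial x_n}\Big)^{\alpha_n}H(x)=C_{2k+1}\,\frac{(-1)^{k+1}}{|x|}\int_{S^{n-1}\cap x^{\perp}}\xi_1^{\alpha_1}\cdots\xi_n^{\alpha_n}f(\xi)\,d\xi,$$ where $|x|$ is the Euclidean norm and $d\xi$ on the right is the (unnormalized) spherical Lebesgue measure of the great subsphere $S^{n-1}\cap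 x^\perp$ (for $n=2$, counting measure on its two points). -/

import Mathlib

open MeasureTheory

noncomputable section

namespace CosineTransform

/-- The unit sphere `S^{n-1}` of `ℝⁿ`, as a type. -/
abbrev Sph (n : ℕ) : Type := Metric.sphere (0 : EuclideanSpace ℝ (Fin n)) 1

/-- The spherical Lebesgue measure on `S^{n-1}` (not normalized). -/
def sphereMeasure (n : ℕ) : Measure (Sph n) :=
  (volume : Measure (EuclideanSpace ℝ (Fin n))).toSphere

/-- The transform `x ↦ ∫ |⟨x, ξ⟩|^p f(ξ) dξ` over `S^{n-1}`, for a natural exponent `p`. -/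
def cosineTransform {n : ℕ} (p : ℕ) (f : Sph n → ℝ) (x : EuclideanSpace ℝ (Fin n)) : ℝ :=
  ∫ ξ : Sph n, |inner ℝ x (ξ : EuclideanSpace ℝ (Fin n))| ^ p * f ξ ∂(sphereMeasure n)

/-- The hyperplane `x^⊥` (for `x ≠ 0`), with the inner product inherited from `ℝⁿ`. -/
abbrev perp {n : ℕ} (x : EuclideanSpace ℝ (Fin n)) : Submodule ℝ (EuclideanSpace ℝ (Fin n)) :=
  (Submodule.span ℝ {x})ᗮ

/-- Lebesgue measure of the Euclidean space `x^⊥`. The instance is spelled out, because `volume`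
on a subtype could also be read as the restriction of the volume of `ℝⁿ`, which vanishes here. -/
def perpVolume {n : ℕ} (x : EuclideanSpace ℝ (Fin n)) : Measure (perp x) :=
  (measureSpaceOfInnerProductSpace : MeasureSpace (perp x)).volume

/-- The inclusion of the unit sphere of `x^⊥` into `S^{n-1}`; its image is `S^{n-1} ∩ x^⊥`. -/
def subsphereIncl {n : ℕ} (x : EuclideanSpace ℝ (Fin n))
    (η : Metric.sphere (0 : perp x) 1) : Sph n :=
  ⟨((η : perp x) : EuclideanSpace ℝ (Fin n)), by
    have h := η.2
    rw [mem_sphere_zero_iff_norm] at h ⊢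
    exact h⟩

/-- The spherical Radon transform `x ↦ ∫ g(ξ) dξ` over `S^{n-1} ∩ x^⊥`, with respect to the
spherical Lebesgue measure of the great subsphere (counting measure on two points if `n = 2`). -/
def sphericalRadon {n : ℕ} (g : Sph n → ℝ) (x : EuclideanSpace ℝ (Fin n)) : ℝ :=
  ∫ η : Metric.sphere (0 : perp x) 1, g (subsphereIncl x η) ∂((perpVolume x).toSphere)

/-- The partial derivative `∂F/∂x_i`. -/
def partialDeriv {n : ℕ} (i : Fin n) (F : EuclideanSpace ℝ (Fin n) → ℝ) :
    EuclideanSpace ℝ (Fin n) → ℝ :=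
  fun x => lineDeriv ℝ F x (EuclideanSpace.single i (1 : ℝ))

/-- `D^α = (∂/∂x_1)^{α_1} (∂/∂x_2)^{α_2} ⋯ (∂/∂x_n)^{α_n}`. -/
def multiDeriv {n : ℕ} (α : Fin n → ℕ) (F : EuclideanSpace ℝ (Fin n) → ℝ) :
    EuclideanSpace ℝ (Fin n) → ℝ :=
  (List.finRange n).foldr (fun i G => (partialDeriv i)^[α i] G) F

/-- `C_t = 2^{t+1} √π Γ((t+1)/2) / Γ(-t/2)`. -/
def constC (t : ℝ) : ℝ :=
  2 ^ (t + 1) * √Real.pi * Real.Gamma ((t + 1) / 2) / Real.Gamma (-t / 2)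

end CosineTransform

end

/-!
The function `|t| ^ (2k+1)` equals `t ^ (2k+1) * sign t`, so the transform of `f` is the case
`m = 2k+1` of the signed transform `T_m g (x) = ∫ ⟨x, ξ⟩ ^ m * sign ⟨x, ξ⟩ * g ξ dξ`, where `g` is a
continuous extension of `f` to `ℝⁿ`.

For `x ≠ 0`, differentiation under the integral sign gives
`∂_v T_{m+1} g = (m+1) T_m (g ⟨v, ·⟩)` (`exists_hasFDerivAt_signedTransform_succ`): the integrand is
Lipschitz in `x`, and it is differentiable at least off the great subsphere orthogonal to `x`, which is
a null set. After `2k+1` derivatives only `T_0` is left, and everything rests on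
`∂_v T_0 g (x) = (2 / ‖x‖) ∫_{S ∩ x^⊥} g ξ ⟨v, ξ⟩ dξ` together with the continuity of this derivative
(`exists_hasFDerivAt_signedTransform_zero`), the rigorous form of `sign' = 2δ`.

To prove the latter, the sphere is thickened: since `sign ⟨x, y⟩` depends only on the direction of
`y`, polar coordinates turn `T_0 g` into a constant times `∫ sign ⟨x, y⟩ h y dy` over `ℝⁿ`, where
`h y = w ‖y‖ * g (y / ‖y‖)` is continuous with compact support. Fix a base point `x₀`, let
`e = x₀ / ‖x₀‖`, and write `y = z + s e` with `z ⊥ x₀`. For `x` near `x₀`, the sign of `⟨x, y⟩` is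
the sign of `s + a` with `a = ⟨x, z⟩ / ⟨x, e⟩`, so the inner integral over `s` is a `C¹` function of
`a` by the fundamental theorem of calculus, and the outer integral over the fixed hyperplane `x₀^⊥`
can be differentiated in `x` under the integral sign
(`exists_hasFDerivAt_integral_realSign_inner`). The derivative at `x₀` itself is an integral of `h`
over `x₀^⊥`, and polar coordinates in `x₀^⊥` bring it back to the great subsphere. There the factor
`⟨v, z⟩` contributes one power of the radius, which makes up for the loss of one dimension, so both
uses of polar coordinates produce the same radial constant.
-/

namespace CosineTransform

open Set Metric Filter Topology

/-! ### Polar coordinates and slicing along a line -/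

/-- Polar coordinates for a function that is a product of a radial and an angular factor. No
integrability is needed, since the Bochner integral of a product over a product space factors
unconditionally. -/
theorem integral_norm_mul_normalize {E : Type*} [NormedAddCommGroup E] [NormedSpace ℝ E]
    [MeasurableSpace E] [BorelSpace E] [FiniteDimensional ℝ E] [Nontrivial E]
    (μ : Measure E) [μ.IsAddHaarMeasure] (φ : ℝ → ℝ) (Q : E → ℝ) :
    ∫ y, φ ‖y‖ * Q (‖y‖⁻¹ • y) ∂μ =
      (∫ ξ : sphere (0 : E) 1, Q ξ ∂μ.toSphere) *
        ∫ r in Ioi (0 : ℝ), r ^ (Module.finrank ℝ E - 1) * φ r := by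
  have h1 : ∫ r : Ioi (0 : ℝ), φ r ∂(Measure.volumeIoiPow (Module.finrank ℝ E - 1)) =
      ∫ r in Ioi (0 : ℝ), r ^ (Module.finrank ℝ E - 1) * φ r := by
    simp only [Measure.volumeIoiPow, ENNReal.ofReal]
    rw [integral_withDensity_eq_integral_smul,
      integral_subtype_comap measurableSet_Ioi
        fun a ↦ Real.toNNReal (a ^ (Module.finrank ℝ E - 1)) • φ a]
    · refine setIntegral_congr_fun measurableSet_Ioi fun x hx ↦ ?_
      simp only [NNReal.smul_def, smul_eq_mul]
      rw [Real.coe_toNNReal _ (pow_nonneg hx.out.le _)]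
    · exact (measurable_subtype_coe.pow_const _).real_toNNReal
  calc ∫ y, φ ‖y‖ * Q (‖y‖⁻¹ • y) ∂μ
      = ∫ y : ({(0)}ᶜ : Set E), φ ‖y.1‖ * Q (‖y.1‖⁻¹ • y.1) ∂(μ.comap (↑)) := by
        rw [integral_subtype_comap (measurableSet_singleton _).compl
          fun y ↦ φ ‖y‖ * Q (‖y‖⁻¹ • y), restrict_compl_singleton]
    _ = ∫ p : sphere (0 : E) 1 × Ioi (0 : ℝ), Q p.1 * φ p.2
          ∂(μ.toSphere.prod (Measure.volumeIoiPow (Module.finrank ℝ E - 1))) := by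
        rw [← μ.measurePreserving_homeomorphUnitSphereProd.integral_comp
          (Homeomorph.measurableEmbedding _)]
        refine integral_congr_ae (Eventually.of_forall fun y ↦ ?_)
        simp [mul_comm]
    _ = _ := by
        rw [integral_prod_mul (fun ξ : sphere (0 : E) 1 ↦ Q ξ) (fun r : Ioi (0 : ℝ) ↦ φ r), h1]

variable {n : ℕ}

instance (x : EuclideanSpace ℝ (Fin n)) : (perpVolume x).IsAddHaarMeasure := by
  unfold perpVolume; infer_instance

/-- Lebesgue measure of `ℝⁿ` is the product of the Lebesgue measures of `x^⊥` and of the line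
through `x`. -/
theorem measurePreserving_perp_add_smul {x : EuclideanSpace ℝ (Fin n)} (hx : x ≠ 0) :
    MeasurePreserving (fun p : perp x × ℝ ↦
      (p.1 : EuclideanSpace ℝ (Fin n)) + p.2 • (‖x‖⁻¹ • x))
      ((perpVolume x).prod volume) volume := by
  have he : ‖‖x‖⁻¹ • x‖ = 1 := norm_smul_inv_norm hx
  have hspan : Submodule.span ℝ {‖x‖⁻¹ • x} = Submodule.span ℝ {x} :=
    Submodule.span_singleton_smul_eq (by simpa using hx) x
  let u : ℝ ≃ₗᵢ[ℝ] Submodule.span ℝ {x} :=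
    (LinearIsometryEquiv.toSpanUnitSingleton (‖x‖⁻¹ • x) he).trans
      (LinearIsometryEquiv.ofEq _ _ hspan)
  let m1 : MeasureSpace (Submodule.span ℝ {x}) := measureSpaceOfInnerProductSpace
  let m2 : MeasureSpace (perp x) := measureSpaceOfInnerProductSpace
  have h1 := (Submodule.span ℝ {x}).orthogonalDecomposition.symm.measurePreserving
  have h2 := WithLp.volume_preserving_toLp (Submodule.span ℝ {x}) (perp x)
  have h3 := u.measurePreserving.prod (MeasurePreserving.id (perpVolume x))
  have h4 := Measure.measurePreserving_swap (μ := perpVolume x) (ν := (volume : Measure ℝ))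
  have h5 := (h1.comp h2).comp (h3.comp h4)
  have h6 : ((Submodule.span ℝ {x}).orthogonalDecomposition.symm ∘ WithLp.toLp 2) ∘
      Prod.map u id ∘ Prod.swap = fun p : perp x × ℝ ↦
      (p.1 : EuclideanSpace ℝ (Fin n)) + p.2 • (‖x‖⁻¹ • x) := by
    ext1 p
    exact add_comm (p.2 • (‖x‖⁻¹ • x)) (p.1 : EuclideanSpace ℝ (Fin n))
  exact h6 ▸ h5

/-! ### Differentiating a signed integral over the whole space -/

theorem measurable_realSign : Measurable Real.sign := by
  unfold Real.sign
  exact Measurable.ite measurableSet_Iio measurable_const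
    (Measurable.ite measurableSet_Ioi measurable_const measurable_const)

theorem abs_realSign_le (t : ℝ) : |Real.sign t| ≤ 1 := by
  rcases Real.sign_apply_eq t with h | h | h <;> simp [h]

theorem realSign_mul_of_pos {c : ℝ} (hc : 0 < c) (t : ℝ) :
    Real.sign (c * t) = Real.sign t := by
  rcases lt_trichotomy t 0 with h | rfl | h
  · rw [Real.sign_of_neg h, Real.sign_of_neg (mul_neg_of_pos_of_neg hc h)]
  · simp
  · rw [Real.sign_of_pos h, Real.sign_of_pos (mul_pos hc h)]

theorem integral_realSign_add_mul {φ : ℝ → ℝ} (hi : Integrable φ) (b : ℝ) :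
    ∫ s, Real.sign (s + b) * φ s = (∫ s, φ s) - 2 * ∫ s in Iic (-b), φ s := by
  have hm : Integrable (fun s ↦ Real.sign (s + b) * φ s) := by
    refine hi.bdd_mul (c := 1)
      (measurable_realSign.comp (measurable_add_const b)).aestronglyMeasurable
      (Eventually.of_forall fun s ↦ abs_realSign_le _)
  have h1 : ∫ s in Iic (-b), Real.sign (s + b) * φ s = -∫ s in Iic (-b), φ s := by
    rw [integral_Iic_eq_integral_Iio, integral_Iic_eq_integral_Iio, ← integral_neg]
    refine setIntegral_congr_fun measurableSet_Iio fun s hs ↦ ?_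
    have : s + b < 0 := by have := hs.out; linarith
    simp [Real.sign_of_neg this]
  have h2 : ∫ s in Ioi (-b), Real.sign (s + b) * φ s = ∫ s in Ioi (-b), φ s := by
    refine setIntegral_congr_fun measurableSet_Ioi fun s hs ↦ ?_
    have : 0 < s + b := by have := hs.out; linarith
    simp [Real.sign_of_pos this]
  rw [← intervalIntegral.integral_Iic_add_Ioi hm.integrableOn hm.integrableOn (b := -b),
    ← intervalIntegral.integral_Iic_add_Ioi hi.integrableOn hi.integrableOn (b := -b), h1, h2]
  ring

theorem hasDerivAt_integral_realSign_add_mul {φ : ℝ → ℝ} (hc : Continuous φ)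
    (hi : Integrable φ) (b : ℝ) :
    HasDerivAt (fun b ↦ ∫ s, Real.sign (s + b) * φ s) (2 * φ (-b)) b := by
  have h0 : (fun b ↦ ∫ s, Real.sign (s + b) * φ s) = fun b ↦
      (∫ s, φ s) - 2 * ((∫ s in Iic 0, φ s) + ∫ s in (0 : ℝ)..(-b), φ s) := by
    ext b
    rw [integral_realSign_add_mul hi, ← intervalIntegral.integral_Iic_sub_Iic hi.integrableOn
      hi.integrableOn]
    ring
  have h1 := (hc.integral_hasStrictDerivAt 0 (-b)).hasDerivAt
  have h2 := h1.comp b (hasDerivAt_neg b)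
  rw [h0]
  refine (((h2.const_add (∫ s in Iic 0, φ s)).const_mul 2).const_sub (∫ s, φ s)).congr_deriv ?_
  ring

theorem inner_inv_norm_smul_self {x : EuclideanSpace ℝ (Fin n)} :
    inner ℝ x (‖x‖⁻¹ • x) = ‖x‖ := by
  rcases eq_or_ne x 0 with rfl | hx
  · simp
  · rw [real_inner_smul_right, real_inner_self_eq_norm_sq]
    have := norm_ne_zero_iff.2 hx
    field_simp

/-- Orthogonal projection to `x^⊥` does not increase the norm. -/
theorem norm_perp_le {x : EuclideanSpace ℝ (Fin n)} (z : perp x) (s : ℝ) :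
    ‖z‖ ≤ ‖(z : EuclideanSpace ℝ (Fin n)) + s • (‖x‖⁻¹ • x)‖ := by
  have h : inner ℝ (z : EuclideanSpace ℝ (Fin n)) (s • (‖x‖⁻¹ • x)) = 0 := by
    rw [real_inner_comm]
    exact z.2 _ (Submodule.smul_mem _ _
      (Submodule.smul_mem _ _ (Submodule.mem_span_singleton_self x)))
  have := norm_add_sq_eq_norm_sq_add_norm_sq_of_inner_eq_zero _ _ h
  rw [Submodule.coe_norm]
  exact abs_le_of_sq_le_sq' (by nlinarith [norm_nonneg (s • (‖x‖⁻¹ • x))]) (norm_nonneg _) |>.2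

/-- The number `a` for which `z - a e` is orthogonal to `x`, provided that `⟨x, e⟩ ≠ 0`. -/
noncomputable def graphSlope (e x z : EuclideanSpace ℝ (Fin n)) : ℝ :=
  inner ℝ x z / inner ℝ x e

/-- The point of the hyperplane `x^⊥` lying over `z` in the direction `e`: as `z` runs through
`e^⊥`, this parametrizes `x^⊥` as a graph. -/
noncomputable def graphPoint (e x z : EuclideanSpace ℝ (Fin n)) : EuclideanSpace ℝ (Fin n) :=
  z + (-graphSlope e x z) • e

theorem hasFDerivAt_slope {e x : EuclideanSpace ℝ (Fin n)} (hx : inner ℝ x e ≠ 0)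
    (z : EuclideanSpace ℝ (Fin n)) :
    HasFDerivAt (fun x ↦ graphSlope e x z) ((inner ℝ x e)⁻¹ • innerSL ℝ (graphPoint e x z)) x := by
  have h1 : ∀ w : EuclideanSpace ℝ (Fin n),
      HasFDerivAt (fun x : EuclideanSpace ℝ (Fin n) ↦ (inner ℝ x w : ℝ)) (innerSL ℝ w) x := by
    intro w
    refine (innerSL ℝ w).hasFDerivAt.congr_of_eventuallyEq (Eventually.of_forall fun y ↦ ?_)
    simp [real_inner_comm]
  refine ((h1 z).mul ((hasDerivAt_inv hx).comp_hasFDerivAt x (h1 e))).congr_fderiv ?_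
  ext v
  simp only [add_apply, smul_apply, innerSL_apply_apply, Function.comp_apply, graphPoint,
    inner_add_left, real_inner_smul_left, smul_eq_mul, graphSlope]
  field_simp
  ring

/-- Near `x₀ ≠ 0`, the function `x ↦ ∫ sign ⟨x, y⟩ h y dy` is differentiable for `h` continuous with
compact support; the derivative `D` is continuous at `x₀`, where it is an integral over `x₀^⊥`. At
points other than `x₀`, `D` is a weighted integral over `x₀^⊥` of the values of `h` at the
points of `x^⊥` lying above it. -/
theorem exists_hasFDerivAt_integral_realSign_inner {h : EuclideanSpace ℝ (Fin n) → ℝ}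
    (hc : Continuous h) (hs : HasCompactSupport h) {x₀ : EuclideanSpace ℝ (Fin n)}
    (hx₀ : x₀ ≠ 0) :
    ∃ D : EuclideanSpace ℝ (Fin n) → EuclideanSpace ℝ (Fin n) →L[ℝ] ℝ,
      (∀ᶠ x in 𝓝 x₀, HasFDerivAt (fun x ↦ ∫ y, Real.sign (inner ℝ x y) * h y) (D x) x) ∧
      ContinuousAt D x₀ ∧
      ∀ v, D x₀ v = 2 / ‖x₀‖ * ∫ z : perp x₀, h z * inner ℝ v (z : EuclideanSpace ℝ (Fin n))
        ∂perpVolume x₀ := by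
  set e := ‖x₀‖⁻¹ • x₀ with he
  have hen : ‖e‖ = 1 := norm_smul_inv_norm hx₀
  have hpos : 0 < ‖x₀‖ := norm_pos_iff.2 hx₀
  obtain ⟨R, hR⟩ := hs.isBounded.subset_closedBall 0
  have hsupp : ∀ y, h y ≠ 0 → ‖y‖ ≤ R := fun y hy ↦ by
    simpa using hR (subset_tsupport _ hy)
  obtain ⟨M, hM⟩ := hc.bounded_above_of_compact_support hs
  -- On `U` the factor `⟨x, e⟩` stays away from `0`.
  set U : Set (EuclideanSpace ℝ (Fin n)) := {x | ‖x₀‖ / 2 < inner ℝ x e} with hU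
  have hUo : IsOpen U := isOpen_lt continuous_const (by fun_prop)
  have hUx : x₀ ∈ U := by
    simp only [hU, mem_ofPred_eq, he, inner_inv_norm_smul_self]
    linarith
  have hUpos : ∀ x ∈ U, 0 < inner ℝ x e := fun x hx ↦ by
    have := hx.out; linarith
  have hmp := measurePreserving_perp_add_smul hx₀
  rw [← he] at hmp
  have hslice_int : ∀ z : perp x₀,
      Integrable fun s : ℝ ↦ h ((z : EuclideanSpace ℝ (Fin n)) + s • e) := by
    intro z
    refine Continuous.integrable_of_hasCompactSupport (by fun_prop) ?_
    refine hs.comp_isClosedEmbedding ?_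
    exact (Homeomorph.addLeft (z : EuclideanSpace ℝ (Fin n))).isClosedEmbedding.comp
      (isClosedEmbedding_smul_left (by rintro h; simp [h] at hen))
  -- The integral over the line through `z`, and the derivative of that integral in `x`.
  let F : EuclideanSpace ℝ (Fin n) → perp x₀ → ℝ := fun x z ↦
    ∫ s, Real.sign (s + graphSlope e x z) * h ((z : EuclideanSpace ℝ (Fin n)) + s • e)
  let F' : EuclideanSpace ℝ (Fin n) → perp x₀ → EuclideanSpace ℝ (Fin n) →L[ℝ] ℝ := fun x z ↦
    (2 * h (graphPoint e x z) * (inner ℝ x e)⁻¹) • innerSL ℝ (graphPoint e x z)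
  -- An integrable majorant of `F'` on `U`: where `h` does not vanish at the graph point, that point
  -- has norm at most `R`, hence so does its projection `z`.
  let B : perp x₀ → ℝ := (closedBall (0 : perp x₀) R).indicator fun _ ↦ 4 * M * R / ‖x₀‖
  have hBi : Integrable B (perpVolume x₀) :=
    (integrable_indicator_iff measurableSet_closedBall).2
      (integrableOn_const (isCompact_closedBall _ _).measure_lt_top.ne)
  have hprod : ∀ x : EuclideanSpace ℝ (Fin n), Integrable (fun p : perp x₀ × ℝ ↦
      Real.sign (inner ℝ x ((p.1 : EuclideanSpace ℝ (Fin n)) + p.2 • e)) *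
        h ((p.1 : EuclideanSpace ℝ (Fin n)) + p.2 • e)) ((perpVolume x₀).prod volume) := by
    intro x
    have h1 : Integrable (fun y : EuclideanSpace ℝ (Fin n) ↦ Real.sign (inner ℝ x y) * h y) := by
      refine (hc.integrable_of_hasCompactSupport hs).bdd_mul (c := 1)
        (measurable_realSign.comp ?_).aestronglyMeasurable
        (Eventually.of_forall fun s ↦ abs_realSign_le _)
      exact (continuous_const.inner continuous_id).measurable
    exact hmp.integrable_comp_of_integrable h1
  have hsign : ∀ x ∈ U, ∀ (z : perp x₀) (s : ℝ),
      Real.sign (inner ℝ x ((z : EuclideanSpace ℝ (Fin n)) + s • e)) =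
        Real.sign (s + graphSlope e x z) := by
    intro x hx z s
    rw [← realSign_mul_of_pos (hUpos x hx) (s + graphSlope e x z)]
    congr 1
    have := (hUpos x hx).ne'
    rw [graphSlope, inner_add_right, real_inner_smul_right]
    field_simp
    ring
  have hG : ∀ x ∈ U, ∫ y, Real.sign (inner ℝ x y) * h y = ∫ z, F x z ∂perpVolume x₀ := by
    intro x hx
    rw [← hmp.map_eq, integral_map hmp.aemeasurable, integral_prod _ (hprod x)]
    · simp only [hsign x hx, F]
    · refine (Measurable.mul (measurable_realSign.comp ?_) hc.measurable).aestronglyMeasurable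
      exact (continuous_const.inner continuous_id).measurable
  have hFi : ∀ x ∈ U, Integrable (F x) (perpVolume x₀) := by
    intro x hx
    have := (hprod x).integral_prod_left
    simpa only [hsign x hx] using this
  have hF'c : ∀ x ∈ U, ∀ z, ContinuousAt (fun q : EuclideanSpace ℝ (Fin n) × perp x₀ ↦ F' q.1 q.2)
      (x, z) := by
    intro x hx z
    have h0 : inner ℝ x e ≠ 0 := (hUpos x hx).ne'
    have h1 : ContinuousAt (fun q : EuclideanSpace ℝ (Fin n) × perp x₀ ↦
        graphPoint e q.1 q.2) (x, z) := by
      unfold graphPoint graphSlope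
      fun_prop (disch := assumption)
    have h2 : ContinuousAt (fun q : EuclideanSpace ℝ (Fin n) × perp x₀ ↦
        (inner ℝ q.1 e)⁻¹) (x, z) := by
      fun_prop (disch := assumption)
    have h3 := hc.continuousAt.comp h1
    have h4 := (innerSL ℝ (E := EuclideanSpace ℝ (Fin n))).continuous.continuousAt.comp h1
    exact ((continuousAt_const.mul h3).mul h2).smul h4
  have hF'm : ∀ x ∈ U, AEStronglyMeasurable (F' x) (perpVolume x₀) := by
    intro x hx
    refine Continuous.aestronglyMeasurable (continuous_iff_continuousAt.2 fun z ↦ ?_)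
    exact (hF'c x hx z).comp (f := fun z ↦ (x, z)) (by fun_prop)
  have hF'b : ∀ z, ∀ x ∈ U, ‖F' x z‖ ≤ B z := by
    intro z x hx
    by_cases hz : h (graphPoint e x z) = 0
    · have hM0 : 0 ≤ M := (norm_nonneg _).trans (hM 0)
      simp only [F', hz, mul_zero, zero_mul, zero_smul, norm_zero, B]
      refine indicator_nonneg (fun y hy ↦ ?_) z
      have : 0 ≤ R := (norm_nonneg _).trans (mem_closedBall_zero_iff.1 hy)
      positivity
    · have h1 := hsupp _ hz
      have h2 : ‖z‖ ≤ R := (norm_perp_le z _).trans h1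
      have h3 : ‖x₀‖ / 2 < inner ℝ x e := hx
      have h4 : (inner ℝ x e)⁻¹ ≤ 2 / ‖x₀‖ := by
        rw [← inv_div]; exact inv_anti₀ (by positivity) h3.le
      have h5 : 0 < (inner ℝ x e)⁻¹ := inv_pos.2 (hUpos x hx)
      have hM' : |h (graphPoint e x z)| ≤ M := hM _
      have hM0 : 0 ≤ M := (norm_nonneg _).trans (hM 0)
      simp only [F', B]
      rw [indicator_of_mem (by simpa using h2), norm_smul, innerSL_apply_norm, Real.norm_eq_abs,
        abs_mul, abs_mul, abs_of_pos h5, abs_of_pos (two_pos : (0 : ℝ) < 2)]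
      calc 2 * |h (graphPoint e x z)| * (inner ℝ x e)⁻¹ * ‖graphPoint e x z‖
          ≤ 2 * M * (2 / ‖x₀‖) * R := by gcongr
        _ = 4 * M * R / ‖x₀‖ := by ring
  have hdiff : ∀ z, ∀ x ∈ U, HasFDerivAt (F · z) (F' x z) x := by
    intro z x hx
    have h1 := (hasDerivAt_integral_realSign_add_mul (by fun_prop) (hslice_int z)
      (graphSlope e x z)).comp_hasFDerivAt x
      (hasFDerivAt_slope (hUpos x hx).ne' (z : EuclideanSpace ℝ (Fin n)))
    refine h1.congr_fderiv ?_
    simp only [F', smul_smul]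
    rfl
  refine ⟨fun x ↦ ∫ z, F' x z ∂perpVolume x₀, ?_, ?_, ?_⟩
  · filter_upwards [hUo.mem_nhds hUx] with x hx
    have hUn := hUo.mem_nhds hx
    have h1 := hasFDerivAt_integral_of_dominated_of_fderiv_le (μ := perpVolume x₀) hUn
      (eventually_of_mem hUn fun y hy ↦ (hFi y hy).aestronglyMeasurable) (hFi x hx) (hF'm x hx)
      (Eventually.of_forall hF'b) hBi (Eventually.of_forall hdiff)
    exact h1.congr_of_eventuallyEq (eventually_of_mem hUn hG)
  · refine continuousAt_of_dominated (bound := B)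
      (eventually_of_mem (hUo.mem_nhds hUx) hF'm)
      (eventually_of_mem (hUo.mem_nhds hUx) fun x hx ↦ Eventually.of_forall fun z ↦ hF'b z x hx)
      hBi (Eventually.of_forall fun z ↦ ?_)
    exact (hF'c x₀ hUx z).comp (f := fun x ↦ (x, z)) (by fun_prop)
  · intro v
    have hint : Integrable (F' x₀) (perpVolume x₀) :=
      hBi.mono' (hF'm x₀ hUx) (Eventually.of_forall fun z ↦ hF'b z x₀ hUx)
    rw [ContinuousLinearMap.integral_apply hint, ← integral_const_mul]
    refine integral_congr_ae (Eventually.of_forall fun z ↦ ?_)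
    have hz : inner ℝ x₀ (z : EuclideanSpace ℝ (Fin n)) = 0 :=
      z.2 _ (Submodule.mem_span_singleton_self x₀)
    have hg : graphPoint e x₀ z = z := by simp [graphPoint, graphSlope, hz]
    have hxe : inner ℝ x₀ e = ‖x₀‖ := inner_inv_norm_smul_self
    simp only [F', hg, hxe, smul_apply,
      innerSL_apply_apply, smul_eq_mul]
    rw [real_inner_comm v]
    ring

/-! ### The signed integral over the sphere -/

/-- The transform `x ↦ ∫ ⟨x, ξ⟩ ^ m * sign ⟨x, ξ⟩ * g ξ dξ` over `S^{n-1}`. The density `g` is defined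
on all of `ℝⁿ`, so that it can be multiplied by linear functions; only its values on the sphere
matter. -/
noncomputable def signedTransform (m : ℕ) (g : EuclideanSpace ℝ (Fin n) → ℝ)
    (x : EuclideanSpace ℝ (Fin n)) : ℝ :=
  ∫ ξ : Sph n, inner ℝ x (ξ : EuclideanSpace ℝ (Fin n)) ^ m *
    Real.sign (inner ℝ x (ξ : EuclideanSpace ℝ (Fin n))) * g ξ ∂(sphereMeasure n)

/-- A continuous profile supported in `[1, 3]`, in particular away from the origin. -/
noncomputable def radialBump (r : ℝ) : ℝ := max 0 (1 - |r - 2|)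

theorem continuous_radialBump : Continuous radialBump := by
  unfold radialBump; fun_prop

theorem radialBump_eq_zero {r : ℝ} (hr : r ≤ 1 ∨ 3 ≤ r) : radialBump r = 0 := by
  rw [radialBump, max_eq_left]
  rcases hr with h | h
  · linarith [neg_abs_le (r - 2)]
  · linarith [le_abs_self (r - 2)]

/-- The radial integral that relates integrals over the sphere to integrals over `ℝⁿ`. -/
noncomputable def bumpMass (n : ℕ) : ℝ := ∫ r in Ioi (0 : ℝ), r ^ (n - 1) * radialBump r

theorem bumpMass_pos (n : ℕ) : 0 < bumpMass n := by
  have hc : Continuous fun r : ℝ ↦ r ^ (n - 1) * radialBump r :=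
    (continuous_pow _).mul continuous_radialBump
  have h1 : bumpMass n = ∫ r in (1 : ℝ)..3, r ^ (n - 1) * radialBump r := by
    rw [bumpMass, intervalIntegral.integral_of_le (by norm_num)]
    refine setIntegral_eq_of_subset_of_forall_sdiff_eq_zero measurableSet_Ioi
      (fun r hr ↦ lt_trans one_pos hr.1) fun r hr ↦ ?_
    have : r ≤ 1 ∨ 3 ≤ r := by
      by_contra! h
      exact hr.2 ⟨h.1, h.2.le⟩
    rw [radialBump_eq_zero this, mul_zero]
  rw [h1]
  refine intervalIntegral.intervalIntegral_pos_of_pos_on (hc.intervalIntegrable _ _)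
    (fun r hr ↦ ?_) (by norm_num)
  have h2 : |r - 2| < 1 := abs_lt.2 ⟨by linarith [hr.1], by linarith [hr.2]⟩
  have h3 : 0 < radialBump r := lt_max_of_lt_right (by linarith)
  have h4 : 0 < r := by linarith [hr.1]
  positivity

/-- The function `y ↦ w ‖y‖ * g (y / ‖y‖)` that spreads the values of `g` on the unit sphere radially
over the shell `1 ≤ ‖y‖ ≤ 3`. -/
noncomputable def spread (g : EuclideanSpace ℝ (Fin n) → ℝ) (y : EuclideanSpace ℝ (Fin n)) : ℝ :=
  radialBump ‖y‖ * g (‖y‖⁻¹ • y)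

theorem spread_eventuallyEq_zero (g : EuclideanSpace ℝ (Fin n) → ℝ) :
    spread g =ᶠ[𝓝 0] 0 := by
  filter_upwards [ball_mem_nhds (0 : EuclideanSpace ℝ (Fin n)) one_pos] with y hy
  simp [spread, radialBump_eq_zero (Or.inl (mem_ball_zero_iff.1 hy).le)]

theorem continuous_spread {g : EuclideanSpace ℝ (Fin n) → ℝ} (hg : Continuous g) :
    Continuous (spread g) := by
  refine continuous_iff_continuousAt.2 fun y ↦ ?_
  rcases eq_or_ne y 0 with rfl | hy
  · exact (continuousAt_const (y := (0 : ℝ))).congr (spread_eventuallyEq_zero g).symm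
  · have h1 : ContinuousAt (fun y : EuclideanSpace ℝ (Fin n) ↦ ‖y‖⁻¹ • y) y :=
      (continuous_norm.continuousAt.inv₀ (norm_ne_zero_iff.2 hy)).smul continuousAt_id
    exact (continuous_radialBump.comp continuous_norm).continuousAt.mul
      (ContinuousAt.comp hg.continuousAt h1)

theorem hasCompactSupport_spread (g : EuclideanSpace ℝ (Fin n) → ℝ) :
    HasCompactSupport (spread g) := by
  refine HasCompactSupport.intro (isCompact_closedBall 0 3) fun y hy ↦ ?_
  have : 3 ≤ ‖y‖ := by simpa using (not_le.1 (mt mem_closedBall_zero_iff.2 hy)).le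
  simp [spread, radialBump_eq_zero (Or.inr this)]

theorem integral_realSign_inner_spread (hn : 2 ≤ n) (g : EuclideanSpace ℝ (Fin n) → ℝ)
    (x : EuclideanSpace ℝ (Fin n)) :
    ∫ y, Real.sign (inner ℝ x y) * spread g y = bumpMass n * signedTransform 0 g x := by
  have : Nonempty (Fin n) := ⟨⟨0, by omega⟩⟩
  have h1 := integral_norm_mul_normalize (volume : Measure (EuclideanSpace ℝ (Fin n))) radialBump
    (fun u ↦ Real.sign (inner ℝ x u) * g u)
  rw [finrank_euclideanSpace_fin] at h1
  simp only [signedTransform, pow_zero, one_mul]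
  rw [mul_comm]
  refine Eq.trans (integral_congr_ae (Eventually.of_forall fun y ↦ ?_)) h1
  rcases eq_or_ne y 0 with rfl | hy
  · simp [spread, radialBump_eq_zero]
  · simp only [spread, real_inner_smul_right,
      realSign_mul_of_pos (inv_pos.2 (norm_pos_iff.2 hy))]
    ring

theorem finrank_perp {x : EuclideanSpace ℝ (Fin n)} (hx : x ≠ 0) :
    Module.finrank ℝ (perp x) = n - 1 := by
  have h1 := (Submodule.span ℝ {x}).finrank_add_finrank_orthogonal
  rw [finrank_span_singleton hx, finrank_euclideanSpace_fin] at h1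
  exact Nat.eq_sub_of_add_eq' h1

/-- The polar weight of the `(n-1)`-dimensional space `x^⊥` is `r ^ (n-2)`; the linear factor `⟨v, z⟩`
supplies the missing power of `r`, so that the same radial constant appears as on `ℝⁿ`. -/
theorem integral_perp_spread_mul_inner (hn : 2 ≤ n) (g : EuclideanSpace ℝ (Fin n) → ℝ)
    {x : EuclideanSpace ℝ (Fin n)} (hx : x ≠ 0) (v : EuclideanSpace ℝ (Fin n)) :
    ∫ z : perp x, spread g z * inner ℝ v (z : EuclideanSpace ℝ (Fin n)) ∂perpVolume x =
      bumpMass n * sphericalRadon (fun ξ ↦ g ξ * inner ℝ v (ξ : EuclideanSpace ℝ (Fin n))) x := by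
  have hd := finrank_perp hx
  have : Nontrivial (perp x) := Module.nontrivial_of_finrank_pos (R := ℝ) (by omega)
  have h1 := integral_norm_mul_normalize (perpVolume x) (fun r ↦ r * radialBump r)
    (fun u ↦ g u * inner ℝ v (u : EuclideanSpace ℝ (Fin n)))
  have h2 : ∫ r in Ioi (0 : ℝ), r ^ (n - 1 - 1) * (r * radialBump r) = bumpMass n := by
    simp only [bumpMass, ← mul_assoc, ← pow_succ]
    rw [Nat.sub_add_cancel (by omega)]
  rw [hd, h2, mul_comm] at h1
  refine Eq.trans (integral_congr_ae (Eventually.of_forall fun z ↦ ?_)) h1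
  rcases eq_or_ne z 0 with rfl | hz
  · simp [spread, radialBump_eq_zero]
  · have : ‖z‖ ≠ 0 := norm_ne_zero_iff.2 hz
    simp only [spread, Submodule.coe_smul, real_inner_smul_right, Submodule.coe_norm] at this ⊢
    field_simp

/-- The derivative of `x ↦ ∫ sign ⟨x, ξ⟩ g ξ dξ` at `x₀ ≠ 0` is an integral over the great subsphere
orthogonal to `x₀`, and it depends continuously on the point. -/
theorem exists_hasFDerivAt_signedTransform_zero (hn : 2 ≤ n) {g : EuclideanSpace ℝ (Fin n) → ℝ}
    (hg : Continuous g) {x₀ : EuclideanSpace ℝ (Fin n)} (hx₀ : x₀ ≠ 0) :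
    ∃ D : EuclideanSpace ℝ (Fin n) → EuclideanSpace ℝ (Fin n) →L[ℝ] ℝ,
      (∀ᶠ x in 𝓝 x₀, HasFDerivAt (signedTransform 0 g) (D x) x) ∧ ContinuousAt D x₀ ∧
      ∀ v, D x₀ v = 2 / ‖x₀‖ *
        sphericalRadon (fun ξ ↦ g ξ * inner ℝ v (ξ : EuclideanSpace ℝ (Fin n))) x₀ := by
  obtain ⟨D, hD, hDc, hDv⟩ := exists_hasFDerivAt_integral_realSign_inner (continuous_spread hg)
    (hasCompactSupport_spread g) hx₀
  have hc := (bumpMass_pos n).ne'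
  refine ⟨(bumpMass n)⁻¹ • D, hD.mono fun x hx ↦ ?_, hDc.const_smul _, fun v ↦ ?_⟩
  · refine (hx.const_mul (bumpMass n)⁻¹).congr_of_eventuallyEq (Eventually.of_forall fun y ↦ ?_)
    simp only [integral_realSign_inner_spread hn]
    field_simp
  · rw [Pi.smul_apply, smul_apply, hDv, integral_perp_spread_mul_inner hn g hx₀, smul_eq_mul]
    field_simp

/-! ### Derivatives and smoothness of the signed transform -/

instance : IsFiniteMeasure (sphereMeasure n) := by
  unfold sphereMeasure; infer_instance

theorem abs_inner_sphere_le (x : EuclideanSpace ℝ (Fin n)) (ξ : Sph n) :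
    |inner ℝ x (ξ : EuclideanSpace ℝ (Fin n))| ≤ ‖x‖ := by
  simpa using abs_real_inner_le_norm x (ξ : EuclideanSpace ℝ (Fin n))

/-- Great subspheres are null sets: the cone over one lies in a hyperplane. -/
theorem ae_inner_ne_zero {x : EuclideanSpace ℝ (Fin n)} (hx : x ≠ 0) :
    ∀ᵐ ξ : Sph n ∂sphereMeasure n, inner ℝ x (ξ : EuclideanSpace ℝ (Fin n)) ≠ 0 := by
  have hm : MeasurableSet {ξ : Sph n | inner ℝ x (ξ : EuclideanSpace ℝ (Fin n)) = 0} :=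
    (isClosed_eq (by fun_prop) continuous_const).measurableSet
  have h0 : volume (perp x : Set (EuclideanSpace ℝ (Fin n))) = 0 := by
    refine Measure.addHaar_submodule _ _ fun h ↦ hx ?_
    have : x ∈ perp x := h ▸ Submodule.mem_top
    exact inner_self_eq_zero.1 (this x (Submodule.mem_span_singleton_self x))
  rw [ae_iff]
  simp only [not_not]
  rw [sphereMeasure, Measure.toSphere_apply' _ hm]
  refine mul_eq_zero_of_right _ (measure_mono_null ?_ h0)
  rintro _ ⟨r, -, _, ⟨ξ, hξ, rfl⟩, rfl⟩
  refine Submodule.smul_mem _ r (Submodule.mem_orthogonal_singleton_iff_inner_right.2 hξ)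

theorem abs_pow_mul_realSign_le (m : ℕ) (t : ℝ) : |t ^ m * Real.sign t| ≤ |t| ^ m := by
  rw [abs_mul, abs_pow]
  exact mul_le_of_le_one_right (by positivity) (abs_realSign_le t)

theorem mul_realSign (t : ℝ) : t * Real.sign t = |t| := by
  rcases lt_trichotomy t 0 with h | rfl | h
  · rw [Real.sign_of_neg h, abs_of_neg h]; ring
  · simp
  · rw [Real.sign_of_pos h, abs_of_pos h]; ring

/-- By induction from `t * sign t = |t|`, the function `t ^ (m+1) * sign t` is Lipschitz on bounded
intervals. -/
theorem exists_lipschitz_pow_mul_realSign (m : ℕ) (R : ℝ) :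
    ∃ K, ∀ t u : ℝ, |t| ≤ R → |u| ≤ R →
      |t ^ (m + 1) * Real.sign t - u ^ (m + 1) * Real.sign u| ≤ K * |t - u| := by
  induction m with
  | zero =>
    refine ⟨1, fun t u _ _ ↦ ?_⟩
    simpa [mul_realSign] using abs_abs_sub_abs_le_abs_sub t u
  | succ m ih =>
    obtain ⟨K, hK⟩ := ih
    refine ⟨R * K + R ^ (m + 1), fun t u ht hu ↦ ?_⟩
    have hR : 0 ≤ R := (abs_nonneg t).trans ht
    have h1 : t ^ (m + 1 + 1) * Real.sign t - u ^ (m + 1 + 1) * Real.sign u =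
        t * (t ^ (m + 1) * Real.sign t - u ^ (m + 1) * Real.sign u) +
          (t - u) * (u ^ (m + 1) * Real.sign u) := by ring
    rw [h1]
    refine (abs_add_le _ _).trans ?_
    rw [abs_mul, abs_mul]
    calc |t| * |t ^ (m + 1) * Real.sign t - u ^ (m + 1) * Real.sign u| +
          |t - u| * |u ^ (m + 1) * Real.sign u|
        ≤ R * (K * |t - u|) + |t - u| * R ^ (m + 1) := by
          gcongr
          · exact hK t u ht hu
          · exact (abs_pow_mul_realSign_le _ _).trans (by gcongr)
      _ = (R * K + R ^ (m + 1)) * |t - u| := by ring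

theorem hasDerivAt_pow_mul_realSign (m : ℕ) {t : ℝ} (ht : t ≠ 0) :
    HasDerivAt (fun t ↦ t ^ (m + 1) * Real.sign t) ((m + 1) * (t ^ m * Real.sign t)) t := by
  have h1 : (fun u ↦ u ^ (m + 1) * Real.sign u) =ᶠ[𝓝 t] fun u ↦ u ^ (m + 1) * Real.sign t := by
    rcases lt_or_gt_of_ne ht with h | h
    · filter_upwards [Iio_mem_nhds h] with u hu
      rw [Real.sign_of_neg h, Real.sign_of_neg hu]
    · filter_upwards [Ioi_mem_nhds h] with u hu
      rw [Real.sign_of_pos h, Real.sign_of_pos hu]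
  refine (((hasDerivAt_pow (m + 1) t).mul_const _).congr_of_eventuallyEq h1).congr_deriv ?_
  push_cast
  ring

theorem exists_bound_on_sphere {g : EuclideanSpace ℝ (Fin n) → ℝ} (hg : Continuous g) :
    ∃ M, 0 ≤ M ∧ ∀ ξ : Sph n, |g ξ| ≤ M := by
  obtain ⟨M, hM⟩ := (isCompact_sphere (0 : EuclideanSpace ℝ (Fin n)) 1).exists_bound_of_continuousOn
    hg.continuousOn
  exact ⟨max M 0, le_max_right _ _, fun ξ ↦ (hM ξ ξ.2).trans (le_max_left _ _)⟩

theorem aestronglyMeasurable_signed_integrand (m : ℕ) {g : EuclideanSpace ℝ (Fin n) → ℝ}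
    (hg : Continuous g) (x : EuclideanSpace ℝ (Fin n)) :
    AEStronglyMeasurable (fun ξ : Sph n ↦ inner ℝ x (ξ : EuclideanSpace ℝ (Fin n)) ^ m *
      Real.sign (inner ℝ x (ξ : EuclideanSpace ℝ (Fin n))) * g ξ) (sphereMeasure n) := by
  have h1 : Continuous fun ξ : Sph n ↦ inner ℝ x (ξ : EuclideanSpace ℝ (Fin n)) := by fun_prop
  have h2 : Continuous fun ξ : Sph n ↦ g ξ := by fun_prop
  exact (((h1.pow m).measurable.mul (measurable_realSign.comp h1.measurable)).mul
    h2.measurable).aestronglyMeasurable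

theorem integrable_signed_integrand (m : ℕ) {g : EuclideanSpace ℝ (Fin n) → ℝ}
    (hg : Continuous g) (x : EuclideanSpace ℝ (Fin n)) :
    Integrable (fun ξ : Sph n ↦ inner ℝ x (ξ : EuclideanSpace ℝ (Fin n)) ^ m *
      Real.sign (inner ℝ x (ξ : EuclideanSpace ℝ (Fin n))) * g ξ) (sphereMeasure n) := by
  obtain ⟨M, hM0, hM⟩ := exists_bound_on_sphere hg
  refine .of_bound (aestronglyMeasurable_signed_integrand m hg x) (‖x‖ ^ m * M)
    (Eventually.of_forall fun ξ ↦ ?_)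
  rw [Real.norm_eq_abs, abs_mul]
  gcongr
  · exact (abs_pow_mul_realSign_le _ _).trans
      (pow_le_pow_left₀ (abs_nonneg _) (abs_inner_sphere_le x ξ) m)
  · exact hM ξ

/-- The hypothesis `x ≠ 0` matters for `m = 0` only, where the integrand has a kink on the null set
`⟨x, ξ⟩ = 0`. -/
theorem exists_hasFDerivAt_signedTransform_succ (m : ℕ) {g : EuclideanSpace ℝ (Fin n) → ℝ}
    (hg : Continuous g) {x : EuclideanSpace ℝ (Fin n)} (hx : x ≠ 0) :
    ∃ L : EuclideanSpace ℝ (Fin n) →L[ℝ] ℝ, HasFDerivAt (signedTransform (m + 1) g) L x ∧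
      ∀ v, L v = (m + 1) * signedTransform m (fun y ↦ g y * inner ℝ v y) x := by
  obtain ⟨M, hM0, hM⟩ := exists_bound_on_sphere hg
  obtain ⟨K, hK⟩ := exists_lipschitz_pow_mul_realSign m (‖x‖ + 1)
  let F' : Sph n → EuclideanSpace ℝ (Fin n) →L[ℝ] ℝ := fun ξ ↦
    ((m + 1) * (inner ℝ x (ξ : EuclideanSpace ℝ (Fin n)) ^ m *
      Real.sign (inner ℝ x (ξ : EuclideanSpace ℝ (Fin n))) * g ξ)) •
        innerSL ℝ (ξ : EuclideanSpace ℝ (Fin n))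
  have hF'm : AEStronglyMeasurable F' (sphereMeasure n) := by
    refine ((aestronglyMeasurable_signed_integrand m hg x).const_mul _).smul ?_
    exact Continuous.aestronglyMeasurable (by fun_prop)
  have key := hasFDerivAt_integral_of_dominated_loc_of_lip' (μ := sphereMeasure n)
    (F := fun x ξ ↦ inner ℝ x (ξ : EuclideanSpace ℝ (Fin n)) ^ (m + 1) *
      Real.sign (inner ℝ x (ξ : EuclideanSpace ℝ (Fin n))) * g ξ) (F' := F')
    (bound := fun _ ↦ K * M) (ball_mem_nhds x one_pos)
    (fun y _ ↦ aestronglyMeasurable_signed_integrand _ hg y)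
    (integrable_signed_integrand _ hg x) hF'm
    (Eventually.of_forall fun ξ y hy ↦ ?_) (integrable_const _)
    ((ae_inner_ne_zero hx).mono fun ξ hξ ↦ ?_)
  · refine ⟨_, key.2, fun v ↦ ?_⟩
    rw [ContinuousLinearMap.integral_apply key.1, signedTransform, ← integral_const_mul]
    refine integral_congr_ae (Eventually.of_forall fun ξ ↦ ?_)
    simp only [F', smul_apply, innerSL_apply_apply, smul_eq_mul]
    rw [real_inner_comm v]
    ring
  · have hy' : ‖y‖ ≤ ‖x‖ + 1 := by
      have h1 : ‖y - x‖ < 1 := by simpa [dist_eq_norm] using hy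
      linarith [norm_sub_norm_le y x]
    have h1 := hK _ _ ((abs_inner_sphere_le y ξ).trans hy')
      ((abs_inner_sphere_le x ξ).trans (by linarith))
    have h2 := abs_inner_sphere_le (y - x) ξ
    rw [inner_sub_left] at h2
    have hK0 : 0 ≤ K := by
      have := hK (‖x‖ + 1) (‖x‖) (by rw [abs_of_nonneg (by positivity)])
        (by rw [abs_of_nonneg (by positivity)]; linarith)
      simpa using (abs_nonneg _).trans this
    rw [Real.norm_eq_abs, ← sub_mul, abs_mul]
    calc _ ≤ K * ‖y - x‖ * M := by
          gcongr
          · exact h1.trans (by gcongr)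
          · exact hM ξ
      _ = K * M * ‖y - x‖ := by ring
  · have h1 : HasFDerivAt (fun y : EuclideanSpace ℝ (Fin n) ↦
        (inner ℝ y (ξ : EuclideanSpace ℝ (Fin n)) : ℝ))
        (innerSL ℝ (ξ : EuclideanSpace ℝ (Fin n))) x := by
      refine (innerSL ℝ (ξ : EuclideanSpace ℝ (Fin n))).hasFDerivAt.congr_of_eventuallyEq
        (Eventually.of_forall fun y ↦ ?_)
      simp [real_inner_comm]
    refine (((hasDerivAt_pow_mul_realSign m hξ).comp_hasFDerivAt x h1).mul_const
      (g ξ)).congr_fderiv ?_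
    simp only [F', smul_smul]
    congr 1
    ring

theorem contDiffOn_signedTransform (hn : 2 ≤ n) (m : ℕ) {g : EuclideanSpace ℝ (Fin n) → ℝ}
    (hg : Continuous g) :
    ContDiffOn ℝ ((m + 1 : ℕ) : WithTop ℕ∞) (signedTransform m g)
      {x : EuclideanSpace ℝ (Fin n) | x ≠ 0} := by
  have ho : IsOpen {x : EuclideanSpace ℝ (Fin n) | x ≠ 0} := isOpen_ne
  induction m generalizing g with
  | zero =>
    rw [zero_add, Nat.cast_one, show (1 : WithTop ℕ∞) = 0 + 1 from (zero_add 1).symm,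
      contDiffOn_succ_iff_fderiv_of_isOpen ho]
    refine ⟨fun x hx ↦ ?_, by simp, contDiffOn_zero.2 fun x hx ↦ ?_⟩
    all_goals obtain ⟨D, hD, hDc, -⟩ := exists_hasFDerivAt_signedTransform_zero hn hg hx
    · exact hD.self_of_nhds.differentiableAt.differentiableWithinAt
    · exact (hDc.congr (hD.mono fun y hy ↦ hy.fderiv.symm)).continuousWithinAt
  | succ m ih =>
    push_cast
    rw [contDiffOn_succ_iff_fderiv_of_isOpen ho]
    refine ⟨fun x hx ↦ ?_, by simp, contDiffOn_clm_apply.2 fun v ↦ ?_⟩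
    · obtain ⟨L, hL, -⟩ := exists_hasFDerivAt_signedTransform_succ m hg hx
      exact hL.differentiableAt.differentiableWithinAt
    · have hgv : Continuous fun y ↦ g y * inner ℝ v y := by fun_prop
      have h1 := (ih hgv).const_smul ((m : ℝ) + 1)
      push_cast at h1
      refine h1.congr fun x hx ↦ ?_
      obtain ⟨L, hL, hLv⟩ := exists_hasFDerivAt_signedTransform_succ m hg hx
      rw [hL.fderiv, hLv]
      rfl

/-! ### Iterated partial derivatives and the constant -/

theorem partialDeriv_eq_of_hasFDerivAt {F : EuclideanSpace ℝ (Fin n) → ℝ}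
    {L : EuclideanSpace ℝ (Fin n) →L[ℝ] ℝ} {x : EuclideanSpace ℝ (Fin n)}
    (h : HasFDerivAt F L x) (i : Fin n) :
    partialDeriv i F x = L (EuclideanSpace.single i 1) :=
  (h.hasLineDerivAt _).lineDeriv

theorem inner_single_one (i : Fin n) (y : EuclideanSpace ℝ (Fin n)) :
    inner ℝ (EuclideanSpace.single i (1 : ℝ)) y = y i := by
  simp [EuclideanSpace.inner_single_left]

/-- The partial derivative at `x ≠ 0` of a function known only away from the origin. -/
theorem partialDeriv_congr {F G : EuclideanSpace ℝ (Fin n) → ℝ} {c : ℝ}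
    (h : ∀ y, y ≠ 0 → F y = c * G y) {x : EuclideanSpace ℝ (Fin n)} (hx : x ≠ 0)
    {L : EuclideanSpace ℝ (Fin n) →L[ℝ] ℝ} (hG : HasFDerivAt G L x) (i : Fin n) :
    partialDeriv i F x = c * L (EuclideanSpace.single i 1) := by
  have h1 : F =ᶠ[𝓝 x] fun y ↦ c * G y := eventually_of_mem (isOpen_ne.mem_nhds hx) h
  rw [partialDeriv_eq_of_hasFDerivAt ((hG.const_mul c).congr_of_eventuallyEq h1)]
  rfl

/-- Each derivative in direction `i` lowers the exponent by one and multiplies the density by the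
`i`-th coordinate. -/
theorem foldr_partialDeriv_signedTransform (l : List (Fin n)) (m : ℕ)
    {g : EuclideanSpace ℝ (Fin n) → ℝ} (hg : Continuous g) {x : EuclideanSpace ℝ (Fin n)}
    (hx : x ≠ 0) :
    l.foldr partialDeriv (signedTransform (m + l.length) g) x =
      (m + l.length).descFactorial l.length *
        signedTransform m (fun y ↦ g y * (l.map fun i ↦ y i).prod) x := by
  induction l generalizing m x with
  | nil => simp
  | cons i l ih =>
    have hlg : Continuous fun y : EuclideanSpace ℝ (Fin n) ↦ g y * (l.map fun i ↦ y i).prod :=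
      hg.mul (continuous_list_prod l fun i _ ↦ by fun_prop)
    obtain ⟨L, hL, hLv⟩ := exists_hasFDerivAt_signedTransform_succ m hlg hx
    have h1 := fun y (hy : y ≠ 0) ↦ ih (m + 1) hy
    rw [show m + 1 + l.length = m + (i :: l).length by simp; ring] at h1
    rw [List.foldr_cons, partialDeriv_congr h1 hx hL i, hLv]
    simp only [inner_single_one, List.map_cons, List.prod_cons, List.length_cons]
    rw [Nat.descFactorial_succ, show m + (l.length + 1) - l.length = m + 1 by omega]
    push_cast
    have : ∀ y : EuclideanSpace ℝ (Fin n), g y * (l.map fun i ↦ y i).prod * y i =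
      g y * (y i * (l.map fun i ↦ y i).prod) := fun y ↦ by ring
    simp only [this]
    ring

/-- A multi-index derivative as a sequence of single partial derivatives. -/
theorem multiDeriv_eq_foldr (α : Fin n → ℕ) (F : EuclideanSpace ℝ (Fin n) → ℝ) :
    multiDeriv α F =
      ((List.finRange n).flatMap fun i ↦ List.replicate (α i) i).foldr partialDeriv F := by
  have h1 : ∀ (i : Fin n) (a : ℕ) (G : EuclideanSpace ℝ (Fin n) → ℝ),
      (List.replicate a i).foldr partialDeriv G = (partialDeriv i)^[a] G := by
    intro i a G
    induction a with
    | zero => rfl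
    | succ a ih => rw [List.replicate_succ, List.foldr_cons, ih, Function.iterate_succ_apply']
  unfold multiDeriv
  induction List.finRange n with
  | nil => rfl
  | cons i l ih => rw [List.foldr_cons, ih, List.flatMap_cons, List.foldr_append, h1]

/-- `C_{2k+1} = 2 (-1) ^ (k+1) (2k+1)!`, from the recursion `C_{t+2} = -(t+1)(t+2) C_t`. -/
theorem constC_odd (k : ℕ) :
    constC (2 * (k : ℝ) + 1) = 2 * (-1) ^ (k + 1) * (2 * k + 1).factorial := by
  induction k with
  | zero =>
    have h1 := Real.Gamma_add_one (s := -1 / 2) (by norm_num)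
    norm_num at h1
    have h2 : Real.Gamma (-(1 / 2)) = -2 * √Real.pi := by
      rw [Real.Gamma_one_half_eq] at h1; linarith
    have h3 : √Real.pi ≠ 0 := by positivity
    norm_num [constC, h2]
    field_simp
    norm_num
  | succ k ih =>
    have h1 := Real.Gamma_add_one (s := (2 * (k : ℝ) + 1 + 1) / 2) (by positivity)
    have h2 := Real.Gamma_add_one (s := -(2 * (k : ℝ) + 1) / 2 - 1) (by
      have : (0 : ℝ) ≤ k := k.cast_nonneg
      intro h; linarith)
    rw [sub_add_cancel] at h2
    have h3 : constC (2 * ((k + 1 : ℕ) : ℝ) + 1) =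
        -(2 * k + 2) * (2 * k + 3) * constC (2 * (k : ℝ) + 1) := by
      have e1 : (2 * ((k + 1 : ℕ) : ℝ) + 1 + 1) / 2 = (2 * (k : ℝ) + 1 + 1) / 2 + 1 := by
        push_cast; ring
      have e2 : -(2 * ((k + 1 : ℕ) : ℝ) + 1) / 2 = -(2 * (k : ℝ) + 1) / 2 - 1 := by
        push_cast; ring
      have e3 : (2 : ℝ) ^ (2 * ((k + 1 : ℕ) : ℝ) + 1 + 1) = 2 ^ (2 * (k : ℝ) + 1 + 1) * 4 := by
        rw [show 2 * ((k + 1 : ℕ) : ℝ) + 1 + 1 = 2 * (k : ℝ) + 1 + 1 + (2 : ℕ) by push_cast; ring,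
          Real.rpow_add_natCast (by norm_num)]
        norm_num
      unfold constC
      rw [e1, e2, e3, h1, h2]
      have h4 : -(2 * (k : ℝ) + 1) / 2 - 1 ≠ 0 := by
        have : (0 : ℝ) ≤ k := k.cast_nonneg
        intro h; linarith
      have h5 : (2 * (k : ℝ) + 3) * (-(2 * (k : ℝ) + 1) / 2 - 1)⁻¹ = -2 := by
        rw [← div_eq_mul_inv, div_eq_iff h4]
        ring
      simp only [div_eq_mul_inv _ (_ * Real.Gamma _), mul_inv]
      linear_combination (2 * (k : ℝ) + 2) * (2 ^ (2 * (k : ℝ) + 1 + 1) * √Real.pi *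
        Real.Gamma ((2 * k + 1 + 1) / 2) * (Real.Gamma (-(2 * k + 1) / 2 - 1))⁻¹) * h5
    rw [h3, ih, show 2 * (k + 1) + 1 = 2 * k + 1 + 1 + 1 by ring,
      Nat.factorial_succ (2 * k + 1 + 1), Nat.factorial_succ (2 * k + 1)]
    push_cast
    ring

end CosineTransform

theorem theorem2p1 (n : ℕ) (hn : 2 ≤ n) (k : ℕ) (f : CosineTransform.Sph n → ℝ)
    (hf : Continuous f) (hfe : ∀ ξ : CosineTransform.Sph n, f (-ξ) = f ξ) :
    ContDiffOn ℝ ((2 * k + 2 : ℕ) : WithTop ℕ∞) (CosineTransform.cosineTransform (2 * k + 1) f)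
        {x : EuclideanSpace ℝ (Fin n) | x ≠ 0} ∧
      ∀ α : Fin n → ℕ, ∑ i, α i = 2 * k + 2 →
        ∀ x : EuclideanSpace ℝ (Fin n), x ≠ 0 →
          CosineTransform.multiDeriv α (CosineTransform.cosineTransform (2 * k + 1) f) x =
            CosineTransform.constC (2 * (k : ℝ) + 1) * ((-1) ^ (k + 1) / ‖x‖) *
              CosineTransform.sphericalRadon
                (fun ξ => (∏ i, (ξ : EuclideanSpace ℝ (Fin n)) i ^ α i) * f ξ) x := by
  open CosineTransform in
  obtain ⟨g, hgf⟩ := ContinuousMap.exists_restrict_eq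
    (Metric.isClosed_sphere (x := (0 : EuclideanSpace ℝ (Fin n))) (ε := 1)) ⟨f, hf⟩
  have hg : Continuous g := g.continuous
  have hgf : ∀ ξ : Sph n, g ξ = f ξ := fun ξ ↦ DFunLike.congr_fun hgf ξ
  have hH : cosineTransform (2 * k + 1) f = signedTransform (2 * k + 1) g := by
    ext x
    refine integral_congr_ae (Filter.Eventually.of_forall fun ξ ↦ ?_)
    simp only [hgf]
    rw [pow_succ, pow_succ, (even_two_mul k).pow_abs, mul_assoc (_ ^ _) _ (Real.sign _), mul_realSign]
  rw [hH]
  refine ⟨contDiffOn_signedTransform hn _ hg, fun α hα x hx ↦ ?_⟩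
  rw [multiDeriv_eq_foldr]
  set l := (List.finRange n).flatMap fun i ↦ List.replicate (α i) i with hl
  have hlen : l.length = 2 * k + 2 := by
    rw [hl, List.length_flatMap, ← hα, ← List.ofFn_eq_map, List.sum_ofFn]
    simp
  have hprod : ∀ y : EuclideanSpace ℝ (Fin n), (l.map fun i ↦ y i).prod = ∏ i, y i ^ α i := by
    intro y
    rw [← List.prod_ofFn, List.ofFn_eq_map, hl]
    induction List.finRange n with
    | nil => rfl
    | cons i l' ih => simp [List.map_append, ih]
  -- The outermost derivative is split off: it is the one that falls on the sign.
  obtain ⟨i, l', hl'⟩ := List.exists_cons_of_length_eq_add_one hlen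
  have hlen' : l'.length = 2 * k + 1 := by simpa [hl'] using hlen
  have hlg : Continuous fun y : EuclideanSpace ℝ (Fin n) ↦ g y * (l'.map fun i ↦ y i).prod :=
    hg.mul (continuous_list_prod l' fun i _ ↦ by fun_prop)
  obtain ⟨D, hD, -, hDv⟩ := exists_hasFDerivAt_signedTransform_zero hn hlg hx
  have h1 := fun y (hy : y ≠ 0) ↦ foldr_partialDeriv_signedTransform l' 0 hg hy
  rw [zero_add, hlen', Nat.descFactorial_self] at h1
  rw [hl', List.foldr_cons, partialDeriv_congr h1 hx hD.self_of_nhds i, hDv, constC_odd]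
  have h2 : (fun ξ : Sph n ↦ g ξ * (l'.map fun i ↦ (ξ : EuclideanSpace ℝ (Fin n)) i).prod *
      inner ℝ (EuclideanSpace.single i (1 : ℝ)) (ξ : EuclideanSpace ℝ (Fin n))) =
      fun ξ : Sph n ↦ (∏ i, (ξ : EuclideanSpace ℝ (Fin n)) i ^ α i) * f ξ := by
    ext ξ
    rw [← hprod, hl', inner_single_one, hgf, List.map_cons, List.prod_cons]
    ring
  have h3 : ((-1 : ℝ) ^ (k + 1)) * (-1) ^ (k + 1) = 1 := by rw [← mul_pow]; simp
  rw [h2]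
  linear_combination (-2 * ((2 * k + 1).factorial : ℝ) / ‖x‖ *
    sphericalRadon (fun ξ : Sph n ↦ (∏ i, (ξ : EuclideanSpace ℝ (Fin n)) i ^ α i) * f ξ) x) * h3
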